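/- Let $n\ge 2$ and let $S=(|\psi_1\rangle,\dots,|\psi_n\rangle)$ be unit vectors in $\mathbb C^{d_A}\otimes\mathbb C^{d_B}$ that do not all represent the same pure state (i.e. are not all equal up to a phase; this holds in particular whenever they represent $n$ distinct states). No orthogonality or product structure is assumed. For positive semidefinite operators $a$ on $\mathbb C^{d_A}$ and $b$ on $\mathbb C^{d_B}$ put $G_{ij}=\langle\psi_i|(a\otimes b)|\psi_j\rangle$ and, if $G_{ii}\neq 0$ for all $i$, put $$\delta_S(a\otimes b)=\max_{i\ne j}\frac{|G_{ij}|}{\sqrt{G_{ii}G_{jj}}}.$$ The nonlocality constant $\eta$ of $S$ is the supremum of all real $\eta'$ such that $$\eta'\left(\frac{\max_k G_{kk}}{\sum_{j}G_{jj}}-\frac1n\right)\le \delta_S(a\otimes b)$$ for all positive semidefinite $a,b$ such that $G_{ii}\ne 0$ for all $i$. An LOCC protocol is a finite tree. At each inner node one of the two parties applies to their own system a non-destructive measurement, given by finitely many operators $M_1,\dots,M_r$ with $\sum_i M_i^\dagger M_i=I$ and arbitrary finite output dimensions, and communicates the result $i$; the protocol then continues at the $i$-th child. Each leaf is labelled by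 an outcome in $\{1,\dots,n\}$. An $n$-outcome LOCC measurement is a POVM $E_1,\dots,E_n$ of the form $E_k=\sum_m A_m^\dagger A_m\otimes B_m^\dagger B_m$, where $m$ runs over the leaves labelled $k$ of an LOCC protocol and $A_m\otimes B_m$ is the product of the measurement operators along the path from the root to $m$. Then $\eta$ is finite, and every $n$-outcome LOCC measurement $E_1,\dots,E_n$ for discriminating states drawn uniformly from $S$ errs with probability $$p_{\mathrm{error}}=\frac1n\sum_{k=1}^n\sum_{j\ne k}\langle\psi_k|E_j|\psi_k\rangle\;\ge\;\frac{2}{27}\,\frac{\eta^2}{n^5}.$$ -/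

import Mathlib

open scoped Matrix Kronecker ComplexOrder

/-- A finite LOCC protocol (as a tree) in which Alice currently holds `ℂ^dA`, Bob currently holds
`ℂ^dB`, and whose terminating nodes are labelled by outcomes in `Fin n`.  At an inner node one of
the parties applies a non-destructive measurement with finitely many measurement operators `M i`
(of arbitrary finite output dimension `d i`), announces the result `i`, and the protocol
continues in a way that may depend on `i`. -/
inductive LOCCProtocol (n : ℕ) : ℕ → ℕ → Type
  | output {dA dB : ℕ} (k : Fin n) : LOCCProtocol n dA dB
  | alice {dA dB r : ℕ} (d : Fin r → ℕ) (M : (i : Fin r) → Matrix (Fin (d i)) (Fin dA) ℂ)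
      (hM : ∑ i, (M i)ᴴ * M i = 1) (next : (i : Fin r) → LOCCProtocol n (d i) dB) :
      LOCCProtocol n dA dB
  | bob {dA dB r : ℕ} (d : Fin r → ℕ) (M : (i : Fin r) → Matrix (Fin (d i)) (Fin dB) ℂ)
      (hM : ∑ i, (M i)ᴴ * M i = 1) (next : (i : Fin r) → LOCCProtocol n dA (d i)) :
      LOCCProtocol n dA dB

/-- If the measurement operator implemented before a subprotocol is entered is `A ⊗ B`, this is the
sum of `Aₘᴴ Aₘ ⊗ Bₘᴴ Bₘ` over all leaves `m` of the subprotocol with outcome `k`, where `Aₘ ⊗ Bₘ`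
is the total measurement operator implemented upon reaching the leaf `m`. -/
noncomputable def LOCCProtocol.effectFrom {n DA DB : ℕ} :
    {dA dB : ℕ} → LOCCProtocol n dA dB → Matrix (Fin dA) (Fin DA) ℂ →
      Matrix (Fin dB) (Fin DB) ℂ → Fin n → Matrix (Fin DA × Fin DB) (Fin DA × Fin DB) ℂ
  | _, _, .output j, A, B, k => if j = k then (Aᴴ * A) ⊗ₖ (Bᴴ * B) else 0
  | _, _, .alice _ M _ next, A, B, k => ∑ i, (next i).effectFrom (M i * A) B k
  | _, _, .bob _ M _ next, A, B, k => ∑ i, (next i).effectFrom A (M i * B) k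

/-- The POVM implemented by an LOCC protocol: its `k`-th element is the sum of
`Aₘᴴ Aₘ ⊗ Bₘᴴ Bₘ` over all terminating measurement records `m` with outcome `k`. -/
noncomputable def LOCCProtocol.povm {n dA dB : ℕ} (P : LOCCProtocol n dA dB) (k : Fin n) :
    Matrix (Fin dA × Fin dB) (Fin dA × Fin dB) ℂ :=
  P.effectFrom 1 1 k

/-- `E` is an `n`-outcome LOCC measurement on `ℂ^dA ⊗ ℂ^dB`. -/
def IsLOCCMeasurement {n dA dB : ℕ}
    (E : Fin n → Matrix (Fin dA × Fin dB) (Fin dA × Fin dB) ℂ) : Prop :=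
  ∃ P : LOCCProtocol n dA dB, P.povm = E

/-- The matrix element `⟨φ| M |χ⟩`. -/
noncomputable def braket {dA dB : ℕ} (φ : EuclideanSpace ℂ (Fin dA × Fin dB))
    (M : Matrix (Fin dA × Fin dB) (Fin dA × Fin dB) ℂ)
    (χ : EuclideanSpace ℂ (Fin dA × Fin dB)) : ℂ :=
  star (φ : Fin dA × Fin dB → ℂ) ⬝ᵥ (M *ᵥ (χ : Fin dA × Fin dB → ℂ))

/-- The probability that the measurement `E` outputs a wrong index when it is applied to `ψ k`
with `k` uniformly random. -/
noncomputable def errorProbability {n dA dB : ℕ} (ψ : Fin n → EuclideanSpace ℂ (Fin dA × Fin dB))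
    (E : Fin n → Matrix (Fin dA × Fin dB) (Fin dA × Fin dB) ℂ) : ℝ :=
  ∑ k, (1 / (n : ℝ)) * ∑ j ∈ Finset.univ.filter (fun j => j ≠ k), (braket (ψ k) (E j) (ψ k)).re

/-- The largest posterior probability
`max_k ⟨ψ_k|M|ψ_k⟩ / ∑_j ⟨ψ_j|M|ψ_j⟩` of a state given a measurement result with operator `M`. -/
noncomputable def pMax {n dA dB : ℕ} (ψ : Fin n → EuclideanSpace ℂ (Fin dA × Fin dB))
    (M : Matrix (Fin dA × Fin dB) (Fin dA × Fin dB) ℂ) : ℝ :=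
  (⨆ k, (braket (ψ k) M (ψ k)).re) / ∑ j, (braket (ψ j) M (ψ j)).re

/-- The disturbance
`δ_S(M) = max_{i ≠ j} |⟨ψ_i|M|ψ_j⟩| / √(⟨ψ_i|M|ψ_i⟩ ⟨ψ_j|M|ψ_j⟩)`. -/
noncomputable def disturbance {n dA dB : ℕ} (ψ : Fin n → EuclideanSpace ℂ (Fin dA × Fin dB))
    (M : Matrix (Fin dA × Fin dB) (Fin dA × Fin dB) ℂ) : ℝ :=
  ⨆ p : {p : Fin n × Fin n // p.1 ≠ p.2},
    ‖braket (ψ p.1.1) M (ψ p.1.2)‖ /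
      √((braket (ψ p.1.1) M (ψ p.1.1)).re * (braket (ψ p.1.2) M (ψ p.1.2)).re)

/-- The real numbers `η` with `η * (pMax (a ⊗ b) - 1/n) ≤ δ_S(a ⊗ b)` for all positive
semidefinite `a`, `b` such that `⟨ψ_i|a ⊗ b|ψ_i⟩ ≠ 0` for all `i`. -/
def tradeoffConstants {n dA dB : ℕ} (ψ : Fin n → EuclideanSpace ℂ (Fin dA × Fin dB)) : Set ℝ :=
  {η | ∀ (a : Matrix (Fin dA) (Fin dA) ℂ) (b : Matrix (Fin dB) (Fin dB) ℂ),
    a.PosSemidef → b.PosSemidef → (∀ i, braket (ψ i) (a ⊗ₖ b) (ψ i) ≠ 0) →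
      η * (pMax ψ (a ⊗ₖ b) - 1 / (n : ℝ)) ≤ disturbance ψ (a ⊗ₖ b)}

/-- The nonlocality constant of a family of bipartite pure states. -/
noncomputable def nonlocalityConstant {n dA dB : ℕ}
    (ψ : Fin n → EuclideanSpace ℂ (Fin dA × Fin dB)) : ℝ :=
  sSup (tradeoffConstants ψ)

/-! Fix `ε` and put `c = 1/n + ε`. Suppose a product operator `M` has largest posterior exactly `c`.
By the tradeoff, some pair of states then keeps normalised overlap at least `ηε`, while every
posterior is at least `1/n - (n-1)ε`; Cauchy-Schwarz turns this overlap into an error that no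
decomposition of `M` into outcomes can avoid (`norm_braket_sq_le_errorWeight_mul`,
`le_errorWeight_of_pMax_eq`).

A protocol may jump past the level `c` in one measurement. Instead of refining it into weak
measurements, the proof goes by induction on the tree (`le_errorWeight_of_split`): a child exceeding
`c` is mixed with its parent until the level is hit exactly. The mixture is still a product
operator, since only one party acts, so the tight case applies to it; summing over the children
gives the bound for the parent.

Finiteness of `η`: some product vector is orthogonal to one state but not to another, so product
operators can make a posterior arbitrarily small. This forces the largest posterior above `c`,
whereas the disturbance never exceeds 1. -/

/-! ### Matrix elements and Cauchy-Schwarz -/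

theorem braket_add {dA dB : ℕ} (φ χ : EuclideanSpace ℂ (Fin dA × Fin dB))
    (M N : Matrix (Fin dA × Fin dB) (Fin dA × Fin dB) ℂ) :
    braket φ (M + N) χ = braket φ M χ + braket φ N χ := by
  simp [braket, Matrix.add_mulVec, dotProduct_add]

theorem braket_zero {dA dB : ℕ} (φ χ : EuclideanSpace ℂ (Fin dA × Fin dB)) :
    braket φ 0 χ = 0 := by
  simp [braket]

theorem braket_real_smul {dA dB : ℕ} (φ χ : EuclideanSpace ℂ (Fin dA × Fin dB)) (t : ℝ)
    (M : Matrix (Fin dA × Fin dB) (Fin dA × Fin dB) ℂ) :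
    braket φ (t • M) χ = t * braket φ M χ := by
  simp [braket, Matrix.smul_mulVec, dotProduct_smul]

theorem braket_one_self {dA dB : ℕ} (φ : EuclideanSpace ℂ (Fin dA × Fin dB)) :
    (braket φ 1 φ).re = ‖φ‖ ^ 2 := by
  rw [braket, Matrix.one_mulVec, ← inner_self_eq_norm_sq (𝕜 := ℂ) φ,
    EuclideanSpace.inner_eq_star_dotProduct, dotProduct_comm]
  rfl

theorem braket_self_re_nonneg {dA dB : ℕ} (φ : EuclideanSpace ℂ (Fin dA × Fin dB))
    {M : Matrix (Fin dA × Fin dB) (Fin dA × Fin dB) ℂ} (hM : M.PosSemidef) :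
    0 ≤ (braket φ M φ).re :=
  hM.re_dotProduct_nonneg _

open scoped MatrixOrder in
/-- Cauchy-Schwarz for the semi-inner product given by a positive semidefinite matrix. -/
theorem norm_braket_sq_le {dA dB : ℕ} (φ χ : EuclideanSpace ℂ (Fin dA × Fin dB))
    {M : Matrix (Fin dA × Fin dB) (Fin dA × Fin dB) ℂ} (hM : M.PosSemidef) :
    ‖braket φ M χ‖ ^ 2 ≤ (braket φ M φ).re * (braket χ M χ).re := by
  obtain ⟨C, rfl⟩ : ∃ C, M = Cᴴ * C :=
    CStarAlgebra.nonneg_iff_eq_star_mul_self.mp hM.nonneg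
  have key (u v : EuclideanSpace ℂ (Fin dA × Fin dB)) : braket u (Cᴴ * C) v =
      inner ℂ (WithLp.toLp 2 (C *ᵥ u.ofLp)) (WithLp.toLp 2 (C *ᵥ v.ofLp)) := by
    rw [braket, EuclideanSpace.inner_eq_star_dotProduct, ← Matrix.mulVec_mulVec,
      Matrix.dotProduct_mulVec, ← Matrix.star_mulVec, dotProduct_comm]
  have hre (u : EuclideanSpace ℂ (Fin dA × Fin dB)) : (braket u (Cᴴ * C) u).re =
      ‖WithLp.toLp 2 (C *ᵥ u.ofLp)‖ ^ 2 := by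
    rw [key]; exact inner_self_eq_norm_sq (𝕜 := ℂ) _
  rw [hre, hre, key, ← mul_pow]
  exact pow_le_pow_left₀ (norm_nonneg _) (norm_inner_le_norm _ _) 2

theorem norm_braket_le {dA dB : ℕ} (φ χ : EuclideanSpace ℂ (Fin dA × Fin dB))
    {M : Matrix (Fin dA × Fin dB) (Fin dA × Fin dB) ℂ} (hM : M.PosSemidef) :
    ‖braket φ M χ‖ ≤ √((braket φ M φ).re * (braket χ M χ).re) :=
  Real.le_sqrt_of_sq_le (norm_braket_sq_le φ χ hM)

/-- The expectation value `⟨ψ_k|M|ψ_k⟩`. -/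
noncomputable def weight {n dA dB : ℕ} (ψ : Fin n → EuclideanSpace ℂ (Fin dA × Fin dB))
    (M : Matrix (Fin dA × Fin dB) (Fin dA × Fin dB) ℂ) (k : Fin n) : ℝ :=
  (braket (ψ k) M (ψ k)).re

/-- The sum of the expectation values of the operators of wrong outcomes. -/
noncomputable def errorWeight {n dA dB : ℕ} (ψ : Fin n → EuclideanSpace ℂ (Fin dA × Fin dB))
    (E : Fin n → Matrix (Fin dA × Fin dB) (Fin dA × Fin dB) ℂ) : ℝ :=
  ∑ k, ∑ j ∈ Finset.univ.filter (fun j => j ≠ k), weight ψ (E j) k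

/-! ### Unnormalised posteriors and the mixing argument -/

section Weight

variable {n dA dB : ℕ} (ψ : Fin n → EuclideanSpace ℂ (Fin dA × Fin dB))

theorem errorProbability_eq (E : Fin n → Matrix (Fin dA × Fin dB) (Fin dA × Fin dB) ℂ) :
    errorProbability ψ E = 1 / (n : ℝ) * errorWeight ψ E := by
  simp [errorProbability, errorWeight, weight, Finset.mul_sum]

theorem weight_add (M N : Matrix (Fin dA × Fin dB) (Fin dA × Fin dB) ℂ) (k : Fin n) :
    weight ψ (M + N) k = weight ψ M k + weight ψ N k := by
  simp [weight, braket_add]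

theorem weight_zero (k : Fin n) : weight ψ 0 k = 0 := by
  simp [weight, braket_zero]

theorem weight_smul (t : ℝ) (M : Matrix (Fin dA × Fin dB) (Fin dA × Fin dB) ℂ) (k : Fin n) :
    weight ψ (t • M) k = t * weight ψ M k := by
  simp [weight, braket_real_smul]

theorem weight_sum {ι : Type*} (s : Finset ι)
    (M : ι → Matrix (Fin dA × Fin dB) (Fin dA × Fin dB) ℂ) (k : Fin n) :
    weight ψ (∑ i ∈ s, M i) k = ∑ i ∈ s, weight ψ (M i) k := by
  classical
  induction s using Finset.induction_on with
  | empty => simp [weight_zero]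
  | insert i s hi ih => rw [Finset.sum_insert hi, Finset.sum_insert hi, weight_add, ih]

theorem weight_nonneg {M : Matrix (Fin dA × Fin dB) (Fin dA × Fin dB) ℂ} (hM : M.PosSemidef)
    (k : Fin n) : 0 ≤ weight ψ M k :=
  braket_self_re_nonneg _ hM

theorem errorWeight_sum {ι : Type*} (s : Finset ι)
    (F : ι → Fin n → Matrix (Fin dA × Fin dB) (Fin dA × Fin dB) ℂ) :
    errorWeight ψ (fun k => ∑ i ∈ s, F i k) = ∑ i ∈ s, errorWeight ψ (F i) := by
  simp only [errorWeight, weight_sum]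
  rw [Finset.sum_comm]
  exact Finset.sum_congr rfl fun k _ => Finset.sum_comm

theorem errorWeight_smul_add (t : ℝ)
    (E F : Fin n → Matrix (Fin dA × Fin dB) (Fin dA × Fin dB) ℂ) :
    errorWeight ψ (fun k => t • E k + F k) = t * errorWeight ψ E + errorWeight ψ F := by
  simp only [errorWeight, weight_add, weight_smul, Finset.sum_add_distrib, Finset.mul_sum]

/-- Some admixture of `u` brings the largest entry of `v` down to zero. -/
theorem exists_mul_add_le_and_eq {ι : Type*} [Finite ι] (u v : ι → ℝ)
    (hu : ∀ k, u k < 0) (hv : ∃ k, 0 < v k) :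
    ∃ t : ℝ, 0 ≤ t ∧ (∀ k, t * u k + v k ≤ 0) ∧ ∃ k, t * u k + v k = 0 := by
  obtain ⟨k₀, hk₀⟩ := hv
  have : Nonempty ι := ⟨k₀⟩
  -- The required `t` is the largest ratio `v k / (-u k)`: the last constraint to be satisfied is
  -- the one that becomes an equality.
  obtain ⟨m, hm⟩ := Finite.exists_max fun k => v k / (-u k)
  refine ⟨v m / (-u m), ?_, fun k => ?_, m, ?_⟩
  · exact le_trans (div_pos hk₀ (neg_pos.mpr (hu k₀))).le (hm k₀)
  · have := (div_le_iff₀ (neg_pos.mpr (hu k))).mp (hm k)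
    linarith
  · have := (hu m).ne
    field_simp
    ring

/-- Splitting an operator `M` whose posterior distribution is bounded by `c` into parts `N i`: the
parts that violate the bound are mixed with `M` until the bound becomes tight. -/
theorem le_errorWeight_of_split {ι : Type*} [Fintype ι] {c κ : ℝ}
    {S : Set (Matrix (Fin dA × Fin dB) (Fin dA × Fin dB) ℂ)}
    (key : ∀ M ∈ S, ∀ E : Fin n → Matrix (Fin dA × Fin dB) (Fin dA × Fin dB) ℂ,
      (∀ k, (E k).PosSemidef) → ∑ k, E k = M →
      (∀ k, weight ψ M k ≤ c * ∑ j, weight ψ M j) →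
      (∃ k, weight ψ M k = c * ∑ j, weight ψ M j) →
      κ * ∑ j, weight ψ M j ≤ errorWeight ψ E)
    {M : Matrix (Fin dA × Fin dB) (Fin dA × Fin dB) ℂ}
    {N : ι → Matrix (Fin dA × Fin dB) (Fin dA × Fin dB) ℂ}
    (hMS : M ∈ S) (hNS : ∀ i, ∀ t : ℝ, 0 ≤ t → t • M + N i ∈ S) (hMN : ∑ i, N i = M)
    {F : ι → Fin n → Matrix (Fin dA × Fin dB) (Fin dA × Fin dB) ℂ}
    (hF : ∀ i k, (F i k).PosSemidef) (hFN : ∀ i, ∑ k, F i k = N i)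
    (hind : ∀ i, (∀ k, weight ψ (N i) k ≤ c * ∑ j, weight ψ (N i) j) →
      κ * ∑ j, weight ψ (N i) j ≤ errorWeight ψ (F i))
    (hM : ∀ k, weight ψ M k ≤ c * ∑ j, weight ψ M j) :
    κ * ∑ j, weight ψ M j ≤ errorWeight ψ (fun k => ∑ i, F i k) := by
  have hE : ∀ k, (∑ i, F i k).PosSemidef := fun k => Matrix.posSemidef_sum _ fun i _ => hF i k
  have hEM : ∑ k, ∑ i, F i k = M := by
    rw [Finset.sum_comm, ← hMN]
    exact Finset.sum_congr rfl fun i _ => hFN i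
  by_cases htight : ∃ k, weight ψ M k = c * ∑ j, weight ψ M j
  · exact key M hMS _ hE hEM hM htight
  push Not at htight
  have hlt : ∀ k, weight ψ M k - c * ∑ j, weight ψ M j < 0 := fun k =>
    sub_neg.mpr (lt_of_le_of_ne (hM k) (htight k))
  set x := errorWeight ψ (fun k => ∑ i, F i k) with hx
  have hchild : ∀ i, ∃ t : ℝ, 0 ≤ t ∧
      κ * (t * ∑ j, weight ψ M j + ∑ j, weight ψ (N i) j) ≤ t * x + errorWeight ψ (F i) := by
    intro i
    by_cases hgood : ∀ k, weight ψ (N i) k ≤ c * ∑ j, weight ψ (N i) j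
    -- A child within the bound needs no admixture.
    · exact ⟨0, le_rfl, by simpa using hind i hgood⟩
    push Not at hgood
    obtain ⟨t, ht, hle, heq⟩ := exists_mul_add_le_and_eq
      (fun k => weight ψ M k - c * ∑ j, weight ψ M j)
      (fun k => weight ψ (N i) k - c * ∑ j, weight ψ (N i) j) hlt
      (hgood.imp fun k hk => sub_pos.mpr hk)
    have hsum : ∑ j, weight ψ (t • M + N i) j =
        t * ∑ j, weight ψ M j + ∑ j, weight ψ (N i) j := by
      simp only [weight_add, weight_smul, Finset.sum_add_distrib, Finset.mul_sum]
    -- The mixture is decomposed by the whole node's effects, scaled by `t`, plus the child's own,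
    -- so its error weight is `t * x` plus that of the child.
    have hkey := key (t • M + N i) (hNS i t ht) (fun k => t • ∑ i, F i k + F i k)
      (fun k => ((hE k).smul ht).add (hF i k))
      (by rw [Finset.sum_add_distrib, ← Finset.smul_sum, hEM, hFN])
      (fun k => by
        rw [hsum, weight_add, weight_smul]
        have := hle k
        linarith)
      (heq.imp fun k hk => by
        rw [hsum, weight_add, weight_smul]
        linarith)
    rw [hsum, errorWeight_smul_add] at hkey
    exact ⟨t, ht, hkey⟩
  choose t ht hle using hchild
  -- The child errors add up to `x` and the child weights to that of `M`, so both sides acquire the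
  -- common factor `∑ t i + 1`, which cancels.
  have hsum := Finset.sum_le_sum fun i (_ : i ∈ Finset.univ) => hle i
  have hweights : ∑ i, ∑ j, weight ψ (N i) j = ∑ j, weight ψ M j := by
    rw [Finset.sum_comm, ← hMN]
    exact Finset.sum_congr rfl fun k _ => (weight_sum ψ _ _ k).symm
  rw [← Finset.mul_sum, Finset.sum_add_distrib, Finset.sum_add_distrib, ← Finset.sum_mul,
    ← Finset.sum_mul, hweights, ← errorWeight_sum, ← hx] at hsum
  have hpos : 0 < ∑ i, t i + 1 := by
    have := Finset.sum_nonneg fun i (_ : i ∈ Finset.univ) => ht i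
    linarith
  refine le_of_mul_le_mul_left ?_ hpos
  linarith

end Weight

/-! ### Induction over protocol trees -/

namespace LOCCProtocol

variable {n DA DB : ℕ}

theorem posSemidef_effectFrom {dA dB : ℕ} (P : LOCCProtocol n dA dB)
    (A : Matrix (Fin dA) (Fin DA) ℂ) (B : Matrix (Fin dB) (Fin DB) ℂ) (k : Fin n) :
    (P.effectFrom A B k).PosSemidef := by
  induction P with
  | output j =>
    simp only [effectFrom]
    split_ifs
    · exact (Matrix.posSemidef_conjTranspose_mul_self A).kronecker
        (Matrix.posSemidef_conjTranspose_mul_self B)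
    · exact Matrix.PosSemidef.zero
  | alice d M hM next ih => exact Matrix.posSemidef_sum _ fun i _ => ih i _ _
  | bob d M hM next ih => exact Matrix.posSemidef_sum _ fun i _ => ih i _ _

theorem sum_conjTranspose_mul_self {d e r : ℕ} {d' : Fin r → ℕ}
    (M : (i : Fin r) → Matrix (Fin (d' i)) (Fin d) ℂ) (hM : ∑ i, (M i)ᴴ * M i = 1)
    (A : Matrix (Fin d) (Fin e) ℂ) : ∑ i, (M i * A)ᴴ * (M i * A) = Aᴴ * A := by
  calc ∑ i, (M i * A)ᴴ * (M i * A) = ∑ i, Aᴴ * ((M i)ᴴ * M i) * A :=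
        Finset.sum_congr rfl fun i _ => by
          simp only [Matrix.conjTranspose_mul, Matrix.mul_assoc]
    _ = Aᴴ * A := by rw [← Matrix.sum_mul, ← Matrix.mul_sum, hM, Matrix.mul_one]

theorem sum_kronecker {ι : Type*} (s : Finset ι) (a : ι → Matrix (Fin DA) (Fin DA) ℂ)
    (b : Matrix (Fin DB) (Fin DB) ℂ) : ∑ i ∈ s, a i ⊗ₖ b = (∑ i ∈ s, a i) ⊗ₖ b := by
  ext p q
  simp [Matrix.sum_apply, Finset.sum_mul]

theorem kronecker_sum {ι : Type*} (s : Finset ι) (a : Matrix (Fin DA) (Fin DA) ℂ)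
    (b : ι → Matrix (Fin DB) (Fin DB) ℂ) : ∑ i ∈ s, a ⊗ₖ b i = a ⊗ₖ (∑ i ∈ s, b i) := by
  ext p q
  simp [Matrix.sum_apply, Finset.mul_sum]

theorem sum_effectFrom {dA dB : ℕ} (P : LOCCProtocol n dA dB)
    (A : Matrix (Fin dA) (Fin DA) ℂ) (B : Matrix (Fin dB) (Fin DB) ℂ) :
    ∑ k, P.effectFrom A B k = (Aᴴ * A) ⊗ₖ (Bᴴ * B) := by
  induction P with
  | output j => simp [effectFrom]
  | alice d M hM next ih =>
    simp only [effectFrom]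
    rw [Finset.sum_comm, Finset.sum_congr rfl fun i _ => ih i (M i * A) B, sum_kronecker,
      sum_conjTranspose_mul_self M hM]
  | bob d M hM next ih =>
    simp only [effectFrom]
    rw [Finset.sum_comm, Finset.sum_congr rfl fun i _ => ih i A (M i * B), kronecker_sum,
      sum_conjTranspose_mul_self M hM]

/-- A lower bound on the error for product operators whose posterior distribution has maximum
exactly `c` extends to all protocols started with posterior probabilities at most `c`. -/
theorem le_errorWeight_effectFrom {c κ : ℝ} (hκ : κ ≤ 1 - c)
    (ψ : Fin n → EuclideanSpace ℂ (Fin DA × Fin DB))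
    (key : ∀ M ∈ {M | ∃ (a : Matrix (Fin DA) (Fin DA) ℂ) (b : Matrix (Fin DB) (Fin DB) ℂ),
      a.PosSemidef ∧ b.PosSemidef ∧ M = a ⊗ₖ b},
      ∀ E : Fin n → Matrix (Fin DA × Fin DB) (Fin DA × Fin DB) ℂ,
      (∀ k, (E k).PosSemidef) → ∑ k, E k = M →
      (∀ k, weight ψ M k ≤ c * ∑ j, weight ψ M j) →
      (∃ k, weight ψ M k = c * ∑ j, weight ψ M j) →
      κ * ∑ j, weight ψ M j ≤ errorWeight ψ E)
    {dA dB : ℕ} (P : LOCCProtocol n dA dB)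
    (A : Matrix (Fin dA) (Fin DA) ℂ) (B : Matrix (Fin dB) (Fin DB) ℂ)
    (h : ∀ k, weight ψ ((Aᴴ * A) ⊗ₖ (Bᴴ * B)) k ≤
      c * ∑ j, weight ψ ((Aᴴ * A) ⊗ₖ (Bᴴ * B)) j) :
    κ * ∑ j, weight ψ ((Aᴴ * A) ⊗ₖ (Bᴴ * B)) j ≤ errorWeight ψ (P.effectFrom A B) := by
  have hpsd {d e : ℕ} (C : Matrix (Fin d) (Fin e) ℂ) : (Cᴴ * C).PosSemidef :=
    Matrix.posSemidef_conjTranspose_mul_self C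
  induction P with
  | output l =>
    set w := weight ψ ((Aᴴ * A) ⊗ₖ (Bᴴ * B)) with hw
    have hnn : 0 ≤ ∑ j, w j := Finset.sum_nonneg fun j _ =>
      weight_nonneg ψ ((hpsd A).kronecker (hpsd B)) j
    have herr : errorWeight ψ ((output l : LOCCProtocol n _ _).effectFrom A B) =
        ∑ j, w j - w l := by
      have hinner : ∀ k, ∑ j ∈ Finset.univ.filter (fun j => j ≠ k),
          weight ψ ((output l : LOCCProtocol n _ _).effectFrom A B j) k =
          if l = k then 0 else w k := by
        intro k
        have hterm : ∀ j, weight ψ ((output l : LOCCProtocol n _ _).effectFrom A B j) k =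
            if l = j then w k else 0 := by
          intro j
          simp only [effectFrom]
          split_ifs
          · rfl
          · exact weight_zero ψ k
        simp only [hterm]
        rw [Finset.sum_ite_eq]
        simp
      rw [errorWeight, Finset.sum_congr rfl fun k _ => hinner k, eq_sub_iff_add_eq,
        ← Finset.sum_erase_add _ _ (Finset.mem_univ l),
        ← Finset.sum_erase_add _ w (Finset.mem_univ l), if_pos rfl, add_zero]
      congr 1
      exact Finset.sum_congr rfl fun k hk => if_neg (Finset.ne_of_mem_erase hk).symm
    -- A leaf errs on all weight except that of its label, hence on at least the fraction `1 - c ≥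
    -- κ`.
    rw [herr]
    have := h l
    nlinarith [mul_le_mul_of_nonneg_right hκ hnn]
  | alice d M hM next ih =>
    refine le_errorWeight_of_split ψ key ⟨_, _, hpsd A, hpsd B, rfl⟩ (fun i t ht => ?_)
      (N := fun i => ((M i * A)ᴴ * (M i * A)) ⊗ₖ (Bᴴ * B)) ?_
      (fun i k => (next i).posSemidef_effectFrom (M i * A) B k)
      (fun i => (next i).sum_effectFrom (M i * A) B) (fun i hi => ih i _ _ hi) h
    -- Parent and child share Bob's factor, so the mixture remains a product.
    · exact ⟨t • (Aᴴ * A) + (M i * A)ᴴ * (M i * A), _, ((hpsd A).smul ht).add (hpsd (M i * A)),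
        hpsd B, by rw [Matrix.add_kronecker, Matrix.smul_kronecker]⟩
    · rw [sum_kronecker, sum_conjTranspose_mul_self M hM]
  | bob d M hM next ih =>
    refine le_errorWeight_of_split ψ key ⟨_, _, hpsd A, hpsd B, rfl⟩ (fun i t ht => ?_)
      (N := fun i => (Aᴴ * A) ⊗ₖ ((M i * B)ᴴ * (M i * B))) ?_
      (fun i k => (next i).posSemidef_effectFrom A (M i * B) k)
      (fun i => (next i).sum_effectFrom A (M i * B)) (fun i hi => ih i _ _ hi) h
    · exact ⟨_, t • (Bᴴ * B) + (M i * B)ᴴ * (M i * B), hpsd A,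
        ((hpsd B).smul ht).add (hpsd (M i * B)),
        by rw [Matrix.kronecker_add, Matrix.kronecker_smul]⟩
    · rw [kronecker_sum, sum_conjTranspose_mul_self M hM]

end LOCCProtocol

/-! ### Error forced by disturbance -/

section Discrimination

variable {n dA dB : ℕ} {ψ : Fin n → EuclideanSpace ℂ (Fin dA × Fin dB)}

/-- A pair of states with a large overlap cannot be discriminated well. -/
theorem norm_braket_sq_le_errorWeight_mul
    {E : Fin n → Matrix (Fin dA × Fin dB) (Fin dA × Fin dB) ℂ} (hE : ∀ k, (E k).PosSemidef)
    {i j : Fin n} (hij : i ≠ j) :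
    ‖braket (ψ i) (∑ k, E k) (ψ j)‖ ^ 2 ≤
      errorWeight ψ E * (weight ψ (∑ k, E k) i + weight ψ (∑ k, E k) j) := by
  classical
  -- Merge the outcomes into "`i`" and "not `i`": `F` on `ψ i` and `E i` on `ψ j` are both errors.
  set F := ∑ k ∈ Finset.univ.erase i, E k with hFdef
  have hF : F.PosSemidef := Matrix.posSemidef_sum _ fun k _ => hE k
  have hsplit : ∑ k, E k = E i + F := (Finset.add_sum_erase _ _ (Finset.mem_univ i)).symm
  have hnn : ∀ k l, 0 ≤ weight ψ (E k) l := fun k l => weight_nonneg ψ (hE k) l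
  have hFi : weight ψ F i = ∑ k ∈ Finset.univ.filter (fun k => k ≠ i), weight ψ (E k) i := by
    rw [hFdef, weight_sum]
    exact Finset.sum_congr (by ext; simp) fun _ _ => rfl
  have hEj : weight ψ (E i) j ≤ ∑ k ∈ Finset.univ.filter (fun k => k ≠ j), weight ψ (E k) j :=
    Finset.single_le_sum (f := fun k => weight ψ (E k) j) (fun k _ => hnn k j) (by simp [hij])
  have herr : weight ψ F i + weight ψ (E i) j ≤ errorWeight ψ E := by
    refine le_trans (add_le_add hFi.le hEj) ?_
    rw [← Finset.sum_pair (f := fun l => ∑ k ∈ Finset.univ.filter (fun k => k ≠ l),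
      weight ψ (E k) l) hij]
    exact Finset.sum_le_sum_of_subset_of_nonneg (Finset.subset_univ _) fun l _ _ =>
      Finset.sum_nonneg fun k _ => hnn k l
  have h1 : ‖braket (ψ i) (E i) (ψ j)‖ ^ 2 ≤ weight ψ (E i) i * weight ψ (E i) j :=
    norm_braket_sq_le _ _ (hE i)
  have h2 : ‖braket (ψ i) F (ψ j)‖ ^ 2 ≤ weight ψ F i * weight ψ F j :=
    norm_braket_sq_le _ _ hF
  have h3 : ‖braket (ψ i) (∑ k, E k) (ψ j)‖ ≤
      ‖braket (ψ i) (E i) (ψ j)‖ + ‖braket (ψ i) F (ψ j)‖ := by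
    rw [hsplit, braket_add]
    exact norm_add_le _ _
  rw [hsplit, weight_add, weight_add]
  rw [hsplit] at h3
  have p1 := hnn i i
  have p2 := hnn i j
  have q1 := weight_nonneg ψ hF i
  have q2 := weight_nonneg ψ hF j
  set u := ‖braket (ψ i) (E i) (ψ j)‖
  set v := ‖braket (ψ i) F (ψ j)‖
  have hu : 0 ≤ u := norm_nonneg _
  have hv : 0 ≤ v := norm_nonneg _
  -- AM-GM for the cross term; it pairs each error weight with a factor so that `(u + v) ^ 2` is
  -- bounded by a product with the error as one factor.
  have huv : 2 * (u * v) ≤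
      weight ψ (E i) j * weight ψ F j + weight ψ (E i) i * weight ψ F i := by
    have hsq : (2 * (u * v)) ^ 2 ≤
        (weight ψ (E i) j * weight ψ F j + weight ψ (E i) i * weight ψ F i) ^ 2 := by
      have := mul_le_mul h1 h2 (sq_nonneg v) (mul_nonneg p1 p2)
      nlinarith [sq_nonneg (weight ψ (E i) j * weight ψ F j - weight ψ (E i) i * weight ψ F i)]
    exact le_of_sq_le_sq hsq (add_nonneg (mul_nonneg p2 q2) (mul_nonneg p1 q1))
  calc ‖braket (ψ i) (E i + F) (ψ j)‖ ^ 2 ≤ (u + v) ^ 2 :=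
        pow_le_pow_left₀ (norm_nonneg _) h3 2
    _ ≤ (weight ψ F i + weight ψ (E i) j) *
        (weight ψ (E i) i + weight ψ F i + (weight ψ (E i) j + weight ψ F j)) := by
      nlinarith [sq_nonneg (weight ψ F i), sq_nonneg (weight ψ (E i) j),
        mul_nonneg p2 q1]
    _ ≤ _ := mul_le_mul_of_nonneg_right herr (by positivity)

theorem disturbance_le_one {M : Matrix (Fin dA × Fin dB) (Fin dA × Fin dB) ℂ}
    (hM : M.PosSemidef) : disturbance ψ M ≤ 1 :=
  Real.iSup_le (fun _ => div_le_one_of_le₀ (norm_braket_le _ _ hM) (Real.sqrt_nonneg _))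
    zero_le_one

theorem disturbance_nonneg (M : Matrix (Fin dA × Fin dB) (Fin dA × Fin dB) ℂ) :
    0 ≤ disturbance ψ M :=
  Real.iSup_nonneg fun _ => by positivity

theorem zero_mem_tradeoffConstants : (0 : ℝ) ∈ tradeoffConstants ψ := by
  intro a b _ _ _
  rw [zero_mul]
  exact disturbance_nonneg _

theorem braket_self_re_ne_zero {φ : EuclideanSpace ℂ (Fin dA × Fin dB)}
    {M : Matrix (Fin dA × Fin dB) (Fin dA × Fin dB) ℂ} (h : (braket φ M φ).re ≠ 0) :
    braket φ M φ ≠ 0 := fun h0 => h (by rw [h0, Complex.zero_re])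

/-- Lower bound on the error once the largest posterior probability equals `1 / n + ε`. -/
theorem le_errorWeight_of_pMax_eq (hn : 2 ≤ n) {η ε : ℝ} (hη : η ∈ tradeoffConstants ψ)
    (hη0 : 0 ≤ η) (hε : 0 ≤ ε) (hε' : 0 < 1 / (n : ℝ) - (n - 1) * ε)
    {a : Matrix (Fin dA) (Fin dA) ℂ} {b : Matrix (Fin dB) (Fin dB) ℂ}
    (ha : a.PosSemidef) (hb : b.PosSemidef)
    {E : Fin n → Matrix (Fin dA × Fin dB) (Fin dA × Fin dB) ℂ} (hE : ∀ k, (E k).PosSemidef)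
    (hEab : ∑ k, E k = a ⊗ₖ b)
    (hle : ∀ k, weight ψ (a ⊗ₖ b) k ≤ (1 / (n : ℝ) + ε) * ∑ j, weight ψ (a ⊗ₖ b) j)
    (heq : ∃ k, weight ψ (a ⊗ₖ b) k = (1 / (n : ℝ) + ε) * ∑ j, weight ψ (a ⊗ₖ b) j) :
    1 / 2 * (1 / (n : ℝ) - (n - 1) * ε) * (η * ε) ^ 2 * ∑ j, weight ψ (a ⊗ₖ b) j ≤
      errorWeight ψ E := by
  classical
  have hab := ha.kronecker hb
  set w := weight ψ (a ⊗ₖ b) with hw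
  have hwnn : ∀ k, 0 ≤ w k := fun k => weight_nonneg ψ hab k
  have hernn : 0 ≤ errorWeight ψ E := Finset.sum_nonneg fun k _ =>
    Finset.sum_nonneg fun j _ => weight_nonneg ψ (hE j) k
  set W := ∑ j, w j with hW
  rcases (Finset.sum_nonneg fun k (_ : k ∈ Finset.univ) => hwnn k).eq_or_lt with h0 | hWpos
  · rw [hW, ← h0, mul_zero]
    exact hernn
  rw [← hW] at hWpos
  have hn0 : (0 : ℝ) < n := by exact_mod_cast (by omega : 0 < n)
  -- The other `n - 1` weights are each at most `(1/n + ε) * W`; the rest is left for `w k`.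
  have hlow : ∀ k, (1 / (n : ℝ) - (n - 1) * ε) * W ≤ w k := by
    intro k
    have h1 : ∑ j ∈ Finset.univ.erase k, w j ≤
        ∑ j ∈ Finset.univ.erase k, (1 / (n : ℝ) + ε) * W :=
      Finset.sum_le_sum fun j _ => hle j
    rw [Finset.sum_const, Finset.card_erase_of_mem (Finset.mem_univ k), Finset.card_univ,
      Fintype.card_fin, nsmul_eq_mul, Nat.cast_sub (by omega), Nat.cast_one] at h1
    have h2 : w k + ∑ j ∈ Finset.univ.erase k, w j = W :=
      Finset.add_sum_erase _ _ (Finset.mem_univ k)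
    have h3 : ((n : ℝ) - 1) * ((1 / n + ε) * W) =
        W - (1 / (n : ℝ) - (n - 1) * ε) * W := by
      field_simp
      ring
    linarith
  have hwpos : ∀ k, 0 < w k := fun k => lt_of_lt_of_le (mul_pos hε' hWpos) (hlow k)
  have : Nonempty (Fin n) := ⟨⟨0, by omega⟩⟩
  have hpmax : pMax ψ (a ⊗ₖ b) = 1 / (n : ℝ) + ε := by
    have hsup : (⨆ k, w k) = (1 / (n : ℝ) + ε) * W := by
      obtain ⟨k, hk⟩ := heq
      exact le_antisymm (ciSup_le hle) (hk ▸ le_ciSup (Set.finite_range w).bddAbove k)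
    exact (div_eq_iff hWpos.ne').mpr hsup
  have hdist := hη a b ha hb fun i => braket_self_re_ne_zero (hwpos i).ne'
  rw [hpmax, add_sub_cancel_left] at hdist
  have : Nonempty {p : Fin n × Fin n // p.1 ≠ p.2} :=
    ⟨⟨(⟨0, by omega⟩, ⟨1, by omega⟩), by simp⟩⟩
  obtain ⟨⟨⟨i, j⟩, hij⟩, hp⟩ := exists_eq_ciSup_of_finite
    (f := fun p : {p : Fin n × Fin n // p.1 ≠ p.2} => ‖braket (ψ p.1.1) (a ⊗ₖ b) (ψ p.1.2)‖ /
      √((braket (ψ p.1.1) (a ⊗ₖ b) (ψ p.1.1)).re * (braket (ψ p.1.2) (a ⊗ₖ b) (ψ p.1.2)).re))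
  rw [disturbance, ← hp] at hdist
  change η * ε ≤ ‖braket (ψ i) (a ⊗ₖ b) (ψ j)‖ / √(w i * w j) at hdist
  have hwij : 0 < w i * w j := mul_pos (hwpos i) (hwpos j)
  rw [le_div_iff₀ (Real.sqrt_pos.mpr hwij)] at hdist
  have hsq := pow_le_pow_left₀ (mul_nonneg (mul_nonneg hη0 hε) (Real.sqrt_nonneg _)) hdist 2
  rw [mul_pow, Real.sq_sqrt hwij.le] at hsq
  have hmain := norm_braket_sq_le_errorWeight_mul (ψ := ψ) hE hij
  rw [hEab] at hmain
  have hs : 0 < w i + w j := add_pos (hwpos i) (hwpos j)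
  refine le_of_mul_le_mul_right ?_ hs
  refine le_trans ?_ (hsq.trans hmain)
  -- The harmonic mean of two weights is at least their common lower bound.
  have hh : (1 / (n : ℝ) - (n - 1) * ε) * W * (w i + w j) ≤ 2 * (w i * w j) := by
    nlinarith [mul_le_mul_of_nonneg_right (hlow i) (hwnn j),
      mul_le_mul_of_nonneg_right (hlow j) (hwnn i)]
  nlinarith [mul_le_mul_of_nonneg_left hh (sq_nonneg (η * ε))]

end Discrimination

/-! ### Finiteness of the nonlocality constant -/

/-- Two bilinear forms such that every zero of the first is a zero of the second are
proportional. -/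
theorem exists_eq_smul_of_forall_eq_zero {K V W : Type*} [Field K] [AddCommGroup V] [Module K V]
    [AddCommGroup W] [Module K W] (f g : V →ₗ[K] W →ₗ[K] K)
    (h : ∀ x y, f x y = 0 → g x y = 0) : ∃ z : K, g = z • f := by
  by_cases hf : ∀ x y, f x y = 0
  · exact ⟨0, by ext x y; simpa using h x y (hf x y)⟩
  push Not at hf
  obtain ⟨x₀, y₁, hne⟩ := hf
  obtain ⟨y₀, hone⟩ : ∃ y₀, f x₀ y₀ = 1 := ⟨(f x₀ y₁)⁻¹ • y₁, by simp [hne]⟩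
  have hleft : ∀ y, g x₀ y = g x₀ y₀ * f x₀ y := by
    intro y
    have := h x₀ (y - f x₀ y • y₀) (by simp [hone])
    simp only [map_sub, map_smul, smul_eq_mul] at this
    linear_combination this
  have hright : ∀ x, g x y₀ = g x₀ y₀ * f x y₀ := by
    intro x
    have := h (x - f x y₀ • x₀) y₀ (by simp [hone])
    simp only [map_sub, map_smul, smul_eq_mul, LinearMap.sub_apply, LinearMap.smul_apply] at this
    linear_combination this
  refine ⟨g x₀ y₀, ?_⟩
  ext x y
  -- Shift `x` along `x₀` to get value 1 against `y₀`, then subtract from `y` the multiple of `y₀`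
  -- that cancels the form.
  have hzero : f (x + (1 - f x y₀) • x₀) (y + (f x y₀ * f x₀ y - f x y - f x₀ y) • y₀) = 0 := by
    simp only [map_add, map_smul, smul_eq_mul, LinearMap.add_apply, LinearMap.smul_apply, hone]
    ring
  have := h _ _ hzero
  simp only [map_add, map_smul, smul_eq_mul, LinearMap.add_apply, LinearMap.smul_apply, hleft y,
    hright x] at this
  simp only [LinearMap.smul_apply, smul_eq_mul]
  simp only [map_add, map_smul, smul_eq_mul, LinearMap.add_apply, LinearMap.smul_apply,
    hone] at hzero
  linear_combination this - g x₀ y₀ * hzero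

section Bound

variable {dA dB : ℕ}

/-- The bilinear form `(x, y) ↦ ∑ x_i y_j φ_ij` of a bipartite vector. -/
noncomputable def tensorForm (φ : EuclideanSpace ℂ (Fin dA × Fin dB)) :
    (Fin dA → ℂ) →ₗ[ℂ] (Fin dB → ℂ) →ₗ[ℂ] ℂ :=
  Matrix.toLinearMap₂' ℂ (Matrix.of fun i j => φ (i, j))

theorem tensorForm_apply (φ : EuclideanSpace ℂ (Fin dA × Fin dB)) (x : Fin dA → ℂ)
    (y : Fin dB → ℂ) : tensorForm φ x y = ∑ p : Fin dA × Fin dB, x p.1 * y p.2 * φ p := by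
  rw [tensorForm, Matrix.toLinearMap₂'_apply, Fintype.sum_prod_type]
  refine Finset.sum_congr rfl fun i _ => Finset.sum_congr rfl fun j _ => ?_
  simp [mul_assoc]

/-- Otherwise every zero of the form of `χ` would be a zero of that of `φ`, making the forms, and so
the vectors, proportional. -/
theorem exists_tensorForm_eq_zero_and_ne_zero {φ χ : EuclideanSpace ℂ (Fin dA × Fin dB)}
    (h : ∀ z : ℂ, φ ≠ z • χ) : ∃ x y, tensorForm χ x y = 0 ∧ tensorForm φ x y ≠ 0 := by
  by_contra! hcon
  obtain ⟨z, hz⟩ := exists_eq_smul_of_forall_eq_zero _ _ hcon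
  refine h z ?_
  ext ⟨i, j⟩
  have := congrArg (fun f => f (Pi.single i 1) (Pi.single j 1)) hz
  simpa [tensorForm_apply, Fintype.sum_prod_type, Pi.single_apply, Finset.sum_ite_eq] using this

theorem braket_vecMulVec_kronecker (φ : EuclideanSpace ℂ (Fin dA × Fin dB)) (x : Fin dA → ℂ)
    (y : Fin dB → ℂ) :
    braket φ (Matrix.vecMulVec (star x) x ⊗ₖ Matrix.vecMulVec (star y) y) φ =
      star (tensorForm φ x y) * tensorForm φ x y := by
  rw [tensorForm_apply, star_sum, Finset.sum_mul]
  simp only [braket, dotProduct, Matrix.mulVec, Finset.mul_sum]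
  refine Finset.sum_congr rfl fun p _ => Finset.sum_congr rfl fun q _ => ?_
  simp [Matrix.vecMulVec_apply]
  ring

/-- If the states do not all coincide, some product operator makes one of them unlikely. -/
theorem exists_product_weight_lt {n : ℕ} {ψ : Fin n → EuclideanSpace ℂ (Fin dA × Fin dB)}
    (hψ : ∀ i, ψ i ≠ 0) (hdistinct : ∃ i j, ∀ z : ℂ, ψ i ≠ z • ψ j) {c : ℝ} (hc : 0 < c) :
    ∃ (a : Matrix (Fin dA) (Fin dA) ℂ) (b : Matrix (Fin dB) (Fin dB) ℂ),
      a.PosSemidef ∧ b.PosSemidef ∧ (∀ k, 0 < weight ψ (a ⊗ₖ b) k) ∧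
        ∃ j, weight ψ (a ⊗ₖ b) j < c * ∑ k, weight ψ (a ⊗ₖ b) k := by
  obtain ⟨i, j, hij⟩ := hdistinct
  obtain ⟨x, y, hj, hi⟩ := exists_tensorForm_eq_zero_and_ne_zero hij
  -- At `s = 0` the weight of `ψ j` vanishes and that of `ψ i` does not; a small `s > 0` keeps the
  -- strict inequality and makes all weights positive.
  let a : ℝ → Matrix (Fin dA) (Fin dA) ℂ := fun s => Matrix.vecMulVec (star x) x + s • 1
  let b : ℝ → Matrix (Fin dB) (Fin dB) ℂ := fun s => Matrix.vecMulVec (star y) y + s • 1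
  have hpsd {d : ℕ} (v : Fin d → ℂ) : (Matrix.vecMulVec (star v) v).PosSemidef := by
    simpa using Matrix.posSemidef_vecMulVec_self_star (star v)
  have hpd {d : ℕ} (v : Fin d → ℂ) {s : ℝ} (hs : 0 < s) :
      (Matrix.vecMulVec (star v) v + s • (1 : Matrix (Fin d) (Fin d) ℂ)).PosDef :=
    (Matrix.PosDef.one.smul hs).posSemidef_add (hpsd v)
  have hcont : ∀ k, Continuous fun s => weight ψ (a s ⊗ₖ b s) k := by
    intro k
    simp only [weight, braket, dotProduct, Matrix.mulVec, a, b, Matrix.kroneckerMap_apply,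
      Matrix.add_apply, Matrix.smul_apply]
    fun_prop
  have hzero : ∀ k, weight ψ (a 0 ⊗ₖ b 0) k = ‖tensorForm (ψ k) x y‖ ^ 2 := by
    intro k
    simp only [a, b, zero_smul, add_zero, weight, braket_vecMulVec_kronecker]
    rw [Complex.star_def, ← Complex.normSq_eq_conj_mul_self, Complex.ofReal_re,
      Complex.normSq_eq_norm_sq]
  have hlt0 : weight ψ (a 0 ⊗ₖ b 0) j < c * ∑ k, weight ψ (a 0 ⊗ₖ b 0) k := by
    simp only [hzero, hj, norm_zero, ne_eq, OfNat.ofNat_ne_zero, not_false_eq_true, zero_pow]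
    refine mul_pos hc (Finset.sum_pos' (fun k _ => sq_nonneg _) ⟨i, Finset.mem_univ i, ?_⟩)
    exact pow_pos (norm_pos_iff.mpr hi) 2
  have hev := (isOpen_lt (hcont j) (continuous_const.mul
    (continuous_finsetSum Finset.univ fun k _ => hcont k))).mem_nhds hlt0
  obtain ⟨s, hs, hspos⟩ := (Filter.Eventually.and (mem_nhdsWithin_of_mem_nhds hev)
    (self_mem_nhdsWithin (s := Set.Ioi (0 : ℝ)) (a := 0))).exists
  refine ⟨a s, b s, (hpd x hspos).posSemidef, (hpd y hspos).posSemidef, fun k => ?_, j, hs⟩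
  exact ((hpd x hspos).kronecker (hpd y hspos)).re_dotProduct_pos
    (by simpa using hψ k)

/-- If one posterior is below `1/n - (n-1)ε`, the other `n - 1` average above `1/n + ε`, so `pMax -
1/n ≥ ε` while the disturbance is at most 1. Besides finiteness, this yields `κ ≤ 1 - c` at the
leaves. -/
theorem tradeoffConstant_mul_le_one {n : ℕ} (hn : 2 ≤ n)
    {ψ : Fin n → EuclideanSpace ℂ (Fin dA × Fin dB)}
    (hψ : ∀ i, ψ i ≠ 0) (hdistinct : ∃ i j, ∀ z : ℂ, ψ i ≠ z • ψ j) {ε : ℝ} (hε : 0 ≤ ε)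
    (hε' : 0 < 1 / (n : ℝ) - (n - 1) * ε) {η : ℝ} (hη : η ∈ tradeoffConstants ψ) :
    η * ε ≤ 1 := by
  classical
  rcases le_total η 0 with hneg | hη0
  · exact le_trans (mul_nonpos_of_nonpos_of_nonneg hneg hε) zero_le_one
  obtain ⟨a, b, ha, hb, hpos, j, hj⟩ := exists_product_weight_lt hψ hdistinct hε'
  have hdist := hη a b ha hb fun i => braket_self_re_ne_zero (hpos i).ne'
  refine le_trans (mul_le_mul_of_nonneg_left ?_ hη0)
    (hdist.trans (disturbance_le_one (ha.kronecker hb)))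
  set w := weight ψ (a ⊗ₖ b) with hw
  have hW : 0 < ∑ k, w k := Finset.sum_pos (fun k _ => hpos k) ⟨j, Finset.mem_univ j⟩
  have hn2 : (2 : ℝ) ≤ n := by exact_mod_cast hn
  have hle : ∀ k, w k ≤ pMax ψ (a ⊗ₖ b) * ∑ k, w k := by
    intro k
    refine (le_ciSup (Set.finite_range w).bddAbove k).trans (le_of_eq ?_)
    exact (div_mul_cancel₀ _ hW.ne').symm
  have h1 : ∑ k ∈ Finset.univ.erase j, w k ≤
      ∑ k ∈ Finset.univ.erase j, pMax ψ (a ⊗ₖ b) * ∑ k, w k :=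
    Finset.sum_le_sum fun k _ => hle k
  rw [Finset.sum_const, Finset.card_erase_of_mem (Finset.mem_univ j), Finset.card_univ,
    Fintype.card_fin, nsmul_eq_mul, Nat.cast_sub (by omega), Nat.cast_one] at h1
  have h2 : w j + ∑ k ∈ Finset.univ.erase j, w k = ∑ k, w k :=
    Finset.add_sum_erase _ _ (Finset.mem_univ j)
  have h3 : (1 - (1 / (n : ℝ) - (n - 1) * ε)) * ∑ k, w k ≤
      ((n : ℝ) - 1) * pMax ψ (a ⊗ₖ b) * ∑ k, w k := by linarith
  have h4 := le_of_mul_le_mul_right h3 hW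
  have h5 : 1 - (1 / (n : ℝ) - (n - 1) * ε) = ((n : ℝ) - 1) * (1 / n + ε) := by
    field_simp
    ring
  rw [h5] at h4
  have h6 := le_of_mul_le_mul_left h4 (by linarith)
  linarith

theorem isLUB_nonlocalityConstant {n : ℕ} (hn : 2 ≤ n)
    {ψ : Fin n → EuclideanSpace ℂ (Fin dA × Fin dB)}
    (hψ : ∀ i, ψ i ≠ 0) (hdistinct : ∃ i j, ∀ z : ℂ, ψ i ≠ z • ψ j) {ε : ℝ} (hε : 0 < ε)
    (hε' : 0 < 1 / (n : ℝ) - (n - 1) * ε) :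
    IsLUB (tradeoffConstants ψ) (nonlocalityConstant ψ) :=
  isLUB_csSup ⟨0, zero_mem_tradeoffConstants⟩ ⟨1 / ε, fun _ hη =>
    (le_div_iff₀ hε).mpr (tradeoffConstant_mul_le_one hn hψ hdistinct hε.le hε' hη)⟩

/-- The supremum defining the nonlocality constant is attained. -/
theorem IsLUB.mem_tradeoffConstants {n : ℕ} {ψ : Fin n → EuclideanSpace ℂ (Fin dA × Fin dB)}
    {η : ℝ} (h : IsLUB (tradeoffConstants ψ) η) : η ∈ tradeoffConstants ψ := by
  refine h.mem_of_isClosed ⟨0, zero_mem_tradeoffConstants⟩ ?_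
  simp only [tradeoffConstants, Set.ofPred_forall]
  refine isClosed_iInter fun a => isClosed_iInter fun b => isClosed_iInter fun _ =>
    isClosed_iInter fun _ => isClosed_iInter fun _ => ?_
  exact isClosed_le (by fun_prop) continuous_const

end Bound

/-! ### The error bound -/

theorem mainTheorem1 {n dA dB : ℕ} (hn : 2 ≤ n)
    (ψ : Fin n → EuclideanSpace ℂ (Fin dA × Fin dB))
    (hψ : ∀ i, ‖ψ i‖ = 1)
    (hdistinct : ∃ i j, ∀ z : ℂ, ψ i ≠ z • ψ j) :
    IsLUB (tradeoffConstants ψ) (nonlocalityConstant ψ) ∧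
      ∀ E : Fin n → Matrix (Fin dA × Fin dB) (Fin dA × Fin dB) ℂ,
        IsLOCCMeasurement E →
          2 / 27 * (nonlocalityConstant ψ ^ 2 / (n : ℝ) ^ 5) ≤ errorProbability ψ E := by
  have hn2 : (2 : ℝ) ≤ n := by exact_mod_cast hn
  have hn0 : (0 : ℝ) < n := by linarith
  have hn1 : (0 : ℝ) < n - 1 := by linarith
  have hψ0 : ∀ i, ψ i ≠ 0 := fun i => norm_ne_zero_iff.mp (by rw [hψ i]; exact one_ne_zero)
  -- This choice maximises `(1/n - (n-1)ε) * ε ^ 2`.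
  set ε : ℝ := 2 / (3 * n * (n - 1)) with hεdef
  have hε : 0 < ε := by positivity
  have hm : 1 / (n : ℝ) - (n - 1) * ε = 1 / (3 * n) := by
    rw [hεdef]
    field_simp
    ring
  have hε' : 0 < 1 / (n : ℝ) - (n - 1) * ε := by
    rw [hm]
    positivity
  have hlub := isLUB_nonlocalityConstant hn hψ0 hdistinct hε hε'
  refine ⟨hlub, ?_⟩
  rintro _ ⟨P, rfl⟩
  have hη := hlub.mem_tradeoffConstants
  have hη0 : 0 ≤ nonlocalityConstant ψ := hlub.1 zero_mem_tradeoffConstants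
  have hηε := tradeoffConstant_mul_le_one hn hψ0 hdistinct hε.le hε' hη
  set η := nonlocalityConstant ψ
  set κ : ℝ := 1 / 2 * (1 / (n : ℝ) - (n - 1) * ε) * (η * ε) ^ 2 with hκdef
  have hεle : ε ≤ 2 / 3 * (1 / n) := by
    rw [hεdef, div_mul_div_comm, mul_one]
    exact div_le_div_of_nonneg_left zero_le_two (by positivity) (by nlinarith)
  have hninv : 1 / (n : ℝ) ≤ 1 / 2 := one_div_le_one_div_of_le two_pos hn2
  have hκ : κ ≤ 1 - (1 / (n : ℝ) + ε) := by
    have hsq : (η * ε) ^ 2 ≤ 1 := pow_le_one₀ (mul_nonneg hη0 hε.le) hηε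
    have h1 : κ ≤ 1 / 2 * (1 / (n : ℝ) - (n - 1) * ε) :=
      mul_le_of_le_one_right (by linarith) hsq
    have h2 : 1 / (3 * (n : ℝ)) = 1 / 3 * (1 / n) := by field_simp
    rw [hm, h2] at h1
    linarith
  have hweight : ∀ k, weight ψ ((1ᴴ * 1 : Matrix (Fin dA) (Fin dA) ℂ) ⊗ₖ
      (1ᴴ * 1 : Matrix (Fin dB) (Fin dB) ℂ)) k = 1 := by
    intro k
    rw [Matrix.conjTranspose_one, Matrix.conjTranspose_one, Matrix.one_mul, Matrix.one_mul,
      Matrix.one_kronecker_one, weight, braket_one_self, hψ, one_pow]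
  have hbound := P.le_errorWeight_effectFrom hκ ψ
    (fun M hM E hE hEM hle heq => by
      obtain ⟨a, b, ha, hb, rfl⟩ := hM
      exact le_errorWeight_of_pMax_eq hn hη hη0 hε.le hε' ha hb hE hEM hle heq)
    1 1 (fun k => by
      rw [hweight, Finset.sum_congr rfl fun j _ => hweight j, Finset.sum_const, Finset.card_univ,
        Fintype.card_fin, nsmul_eq_mul, mul_one, add_mul, one_div_mul_cancel hn0.ne']
      have := mul_pos hε hn0
      linarith)
  rw [Finset.sum_congr rfl fun j _ => hweight j, Finset.sum_const, Finset.card_univ,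
    Fintype.card_fin, nsmul_eq_mul, mul_one] at hbound
  change κ * n ≤ errorWeight ψ P.povm at hbound
  rw [errorProbability_eq]
  have hκle : κ ≤ 1 / (n : ℝ) * errorWeight ψ P.povm := by
    rw [one_div_mul_eq_div, le_div_iff₀ hn0]
    exact hbound
  refine le_trans ?_ hκle
  -- The argument gives this slightly stronger bound; `n - 1 ≤ n` then yields `n ^ 5`.
  have hκeq : κ = 2 / 27 * (η ^ 2 / ((n : ℝ) ^ 3 * (n - 1) ^ 2)) := by
    rw [hκdef, hm, hεdef]
    field_simp
    ring
  rw [hκeq]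
  refine mul_le_mul_of_nonneg_left
    (div_le_div_of_nonneg_left (sq_nonneg η) (by positivity) ?_) (by norm_num)
  calc (n : ℝ) ^ 3 * (n - 1) ^ 2 ≤ (n : ℝ) ^ 3 * n ^ 2 := by
        gcongr
        linarith
    _ = (n : ℝ) ^ 5 := by ring
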